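/- Let $d \ge 0$ be an integer, let $\mathbb{F}^d$ be the free monoid on $d$ letters, and let $H^2 = \ell^2(\mathbb{F}^d)$ (the full Fock space over $\mathbb{C}^d$, i.e. the NC Hardy space $H^2(\mathbb{B}^d_{\mathbb{N}})$), with orthonormal basis $(e_\alpha)_{\alpha \in \mathbb{F}^d}$. For $1 \le k \le d$ let $L_k$ be the left free shift, $L_k e_\alpha = e_{k\alpha}$, and let $H^\infty = H^\infty(\mathbb{B}^d_{\mathbb{N}})$ be the weak-$*$ closed unital subalgebra of $\mathcal{L}(H^2)$ generated by $L_1, \dots, L_d$. Identify $H^\infty \otimes \mathbb{C}^{n \times k}$ with the $n \times k$ matrices over $H^\infty$, acting as bounded operators (left multipliers) from $H^2 \otimes \mathbb{C}^k$ to $H^2 \otimes \mathbb{C}^n$. (1) If $E \in H^\infty \otimes \mathbb{C}^{n \times n}$ is idempotent, then there are an orthogonal projection $P \in \mathbb{C}^{n \times n}$ and an $S \in \operatorname{GL}_n(H^\infty)$ (that is, $S \in H^\infty \otimes \mathbb{C}^{n\times n}$ with inverse in $H^\infty \otimes \mathbb{C}^{n\times n}$) such that $E = S^{-1} (I_{H^2}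 \otimes P) S$. (2) A left multiplier $F \in H^\infty \otimes \mathbb{C}^{n \times k}$ is invertible, as a bounded operator from $H^2 \otimes \mathbb{C}^k$ to $H^2 \otimes \mathbb{C}^n$, if and only if $n = k$ and $F$ has an inverse in $H^\infty \otimes \mathbb{C}^{n \times n}$. -/

import Mathlib

open scoped ENNReal InnerProductSpace

namespace NCHardy

/-! ## The ultraweak (weak-*) topology on bounded operators -/

section Ultraweak

variable (H : Type*) [NormedAddCommGroup H] [InnerProductSpace ℂ H]

/-- Square-summable sequences of vectors of `H`. -/
def SqSummable : Type _ := {x : ℕ → H // Summable fun k => ‖x k‖ ^ 2}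

variable {H}

theorem summable_pairing (T : H →L[ℂ] H) (x y : SqSummable H) :
    Summable fun k => ⟪y.1 k, T (x.1 k)⟫_ℂ := by
  have hs : Summable fun k => ‖T‖ * (‖y.1 k‖ ^ 2 + ‖x.1 k‖ ^ 2) := (y.2.add x.2).mul_left _
  refine Summable.of_norm_bounded hs fun k => ?_
  have h1 : ‖⟪y.1 k, T (x.1 k)⟫_ℂ‖ ≤ ‖y.1 k‖ * ‖T (x.1 k)‖ := norm_inner_le_norm _ _
  have h2 : ‖y.1 k‖ * ‖T (x.1 k)‖ ≤ ‖y.1 k‖ * (‖T‖ * ‖x.1 k‖) :=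
    mul_le_mul_of_nonneg_left (T.le_opNorm _) (norm_nonneg _)
  have h3 : ‖y.1 k‖ * ‖x.1 k‖ ≤ ‖y.1 k‖ ^ 2 + ‖x.1 k‖ ^ 2 := by
    nlinarith [sq_nonneg (‖y.1 k‖ - ‖x.1 k‖), sq_nonneg (‖y.1 k‖), sq_nonneg (‖x.1 k‖)]
  have h4 := mul_le_mul_of_nonneg_left h3 (norm_nonneg T)
  calc _ ≤ _ := h1.trans h2
    _ = ‖T‖ * (‖y.1 k‖ * ‖x.1 k‖) := by ring
    _ ≤ _ := h4

/-- The pairing of a bounded operator `T` with the trace-class operator `∑ₖ xₖ yₖ*`, for all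
square-summable sequences `x` and `y`: the family of all ultraweakly continuous functionals. -/
noncomputable def pairing (T : H →L[ℂ] H) : SqSummable H × SqSummable H → ℂ :=
  fun p => ∑' k, ⟪p.2.1 k, T (p.1.1 k)⟫_ℂ

theorem pairing_add (S T : H →L[ℂ] H) : pairing (S + T) = pairing S + pairing T := by
  funext p
  simp only [pairing, Pi.add_apply, add_apply, inner_add_right]
  exact (summable_pairing S p.1 p.2).tsum_add (summable_pairing T p.1 p.2)

variable (H)

/-- The weak-* (ultraweak) topology on the bounded operators of `H`, as the dual space of the
trace-class operators. -/
@[reducible] noncomputable def ultraweakTopology : TopologicalSpace (H →L[ℂ] H) :=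
  TopologicalSpace.induced pairing inferInstance

/-- The image of a square-summable sequence under a bounded operator. -/
def SqSummable.map {H : Type*} [NormedAddCommGroup H] [InnerProductSpace ℂ H]
    (A : H →L[ℂ] H) (x : SqSummable H) : SqSummable H :=
  ⟨fun k => A (x.1 k), by
    refine Summable.of_nonneg_of_le (fun _ => sq_nonneg _) (fun k => ?_) (x.2.mul_left (‖A‖ ^ 2))
    rw [← mul_pow]
    exact pow_le_pow_left₀ (norm_nonneg _) (A.le_opNorm _) 2⟩

/-- Addition is jointly, and multiplication separately, ultraweakly continuous. -/
theorem isSemitopologicalSemiring_ultraweak [CompleteSpace H] :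
    @IsSemitopologicalSemiring (H →L[ℂ] H) (ultraweakTopology H) _ := by
  let _ : TopologicalSpace (H →L[ℂ] H) := ultraweakTopology H
  have hc : Continuous (pairing (H := H)) := continuous_induced_dom
  have hcp : ∀ p, Continuous fun T : H →L[ℂ] H => pairing T p := fun p =>
    (continuous_apply p).comp hc
  refine @IsSemitopologicalSemiring.mk _ _ _ ⟨?_⟩ ⟨?_, ?_⟩
  · refine continuous_induced_rng.2 (continuous_pi fun p => ?_)
    refine (((hcp p).comp continuous_fst).add ((hcp p).comp continuous_snd)).congr fun q => ?_
    simp [pairing_add]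
  · intro A
    refine continuous_induced_rng.2 (continuous_pi fun p => ?_)
    refine (hcp (p.1, p.2.map (ContinuousLinearMap.adjoint A))).congr fun T => ?_
    simp [pairing, SqSummable.map, ContinuousLinearMap.adjoint_inner_left]
  · intro A
    refine continuous_induced_rng.2 (continuous_pi fun p => ?_)
    exact hcp (p.1.map A, p.2)

/-- The weak-* closure of an algebra of bounded operators on a Hilbert space. -/
noncomputable def weakStarClosure [CompleteSpace H] (A : Subalgebra ℂ (H →L[ℂ] H)) :
    Subalgebra ℂ (H →L[ℂ] H) :=
  letI := ultraweakTopology H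
  haveI := isSemitopologicalSemiring_ultraweak H
  A.topologicalClosure

end Ultraweak

/-! ## The NC Hardy space and the NC Hardy algebra -/

/-- The NC Hardy space `H²` of the NC unit ball in `d` variables, in its realization as the full
Fock space: square-summable families of coefficients indexed by the free monoid on `d` letters. -/
abbrev HardySpace (d : ℕ) : Type := lp (fun _ : FreeMonoid (Fin d) => ℂ) 2

theorem of_mul_injective {d : ℕ} (k : Fin d) :
    Function.Injective fun w : FreeMonoid (Fin d) => FreeMonoid.of k * w :=
  mul_right_injective _

theorem memℓp_extend {d : ℕ} (k : Fin d) (f : HardySpace d) :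
    Memℓp (Function.extend (fun w => FreeMonoid.of k * w) (f : FreeMonoid (Fin d) → ℂ) 0) 2 := by
  refine memℓp_gen ?_
  refine ((of_mul_injective k).summable_iff fun w hw => ?_).1 ?_
  · rw [Function.extend_apply' _ _ _ (by simpa using hw)]
    simp
  · have := (lp.memℓp f).summable (by norm_num)
    refine this.congr fun w => ?_
    simp [(of_mul_injective k).extend_apply]

/-- The left free shift `L_k`, left multiplication by the `k`-th variable: if
`f = ∑ f_w z^w` then `L_k f = ∑ f_w z^(k w)`. -/
noncomputable def leftShift {d : ℕ} (k : Fin d) : HardySpace d →L[ℂ] HardySpace d :=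
  LinearMap.mkContinuous
    { toFun := fun f => ⟨Function.extend (fun w => FreeMonoid.of k * w)
        (f : FreeMonoid (Fin d) → ℂ) 0, memℓp_extend k f⟩
      map_add' := fun f g => by
        ext w
        change (Function.extend (fun w => FreeMonoid.of k * w)
            ((f : FreeMonoid (Fin d) → ℂ) + (g : FreeMonoid (Fin d) → ℂ)) 0 w : ℂ) =
          Function.extend (fun w => FreeMonoid.of k * w) (f : FreeMonoid (Fin d) → ℂ) 0 w +
            Function.extend (fun w => FreeMonoid.of k * w) (g : FreeMonoid (Fin d) → ℂ) 0 w
        by_cases hw : ∃ v, FreeMonoid.of k * v = w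
        · obtain ⟨v, rfl⟩ := hw
          simp only [(of_mul_injective k).extend_apply, Pi.add_apply]
        · simp only [Function.extend_apply' _ _ _ hw, Pi.zero_apply, add_zero]
      map_smul' := fun c f => by
        ext w
        by_cases hw : ∃ v, FreeMonoid.of k * v = w
        · obtain ⟨v, rfl⟩ := hw
          simp [(of_mul_injective k).extend_apply]
        · simp [Function.extend_apply' _ _ _ hw] }
    1 fun f => by
      rw [one_mul]
      refine le_of_eq ?_
      have h2 : 0 < (2 : ℝ≥0∞).toReal := by norm_num
      rw [lp.norm_eq_tsum_rpow h2, lp.norm_eq_tsum_rpow h2]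
      congr 1
      rw [← (of_mul_injective k).tsum_eq]
      · refine tsum_congr fun w => ?_
        simp [(of_mul_injective k).extend_apply]
      · intro w hw
        by_contra hw'
        refine hw ?_
        simp [Function.extend_apply' _ _ _ (by simpa using hw')]

/-- The NC Hardy algebra `H^∞` (the left free analytic Toeplitz algebra): the weak-* closed unital
algebra of operators on `H²` generated by the left free shifts. -/
noncomputable def HardyAlgebra (d : ℕ) : Subalgebra ℂ (HardySpace d →L[ℂ] HardySpace d) :=
  weakStarClosure (HardySpace d) (Algebra.adjoin ℂ (Set.range (leftShift (d := d))))

/-- The vector-valued NC Hardy space `H² ⊗ ℂⁿ`, with its Hilbert space norm. -/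
abbrev HardySpaceVec (d n : ℕ) : Type := PiLp 2 fun _ : Fin n => HardySpace d

/-- The bounded operator from `H² ⊗ ℂᵏ` to `H² ⊗ ℂⁿ` given by an element of `H^∞ ⊗ ℂ^(n × k)`, that
is, an `n × k` matrix over `H^∞`: `(F x)_i = ∑ j, F_ij x_j`. -/
noncomputable def leftMultiplier {d n k : ℕ} (F : Matrix (Fin n) (Fin k) (HardyAlgebra d)) :
    HardySpaceVec d k →L[ℂ] HardySpaceVec d n :=
  (PiLp.continuousLinearEquiv 2 ℂ fun _ : Fin n => HardySpace d).symm.toContinuousLinearMap ∘L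
    ContinuousLinearMap.pi fun i => ∑ j, (F i j).1 ∘L PiLp.proj 2 (fun _ : Fin k => HardySpace d) j

/-- The constant multiplier `I ⊗ A` of a scalar matrix `A`. -/
noncomputable def constMultiplier {n : ℕ} (d : ℕ) (A : Matrix (Fin n) (Fin n) ℂ) :
    Matrix (Fin n) (Fin n) (HardyAlgebra d) :=
  A.map (algebraMap ℂ (HardyAlgebra d))

end NCHardy

namespace NCHardy

section

variable {d : ℕ}

/-! The bridge between algebra and geometry is `mem_hardyAlgebra_iff`: the weak-* closed algebra
generated by the left shifts is exactly the commutant of the right shifts. An operator commuting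
with the right shifts is convolution by its symbol (`apply_eq_conv`), and the Cesàro means of that
symbol are polynomials in the left shifts, bounded by the norm of the operator
(`norm_cesaroMean_le`) and converging to it ultraweakly. Hence left multipliers are precisely the
bounded operators intertwining the right shifts.

Statement (2) follows: the inverse of an intertwiner is an intertwiner, and taking constant
coefficients, a ring homomorphism to `ℂ`, forces the matrix to be square.

For (1), the range `M` and kernel `N` of an idempotent multiplier are complementary closed subspaces
invariant under the right shifts. By a Beurling-type theorem (`exists_intertwining`) each is a copy
of as many Fock spaces as its wandering subspace has dimensions. Taking constant terms identifies
the sum of the two wandering subspaces with `ℂⁿ` (`bijective_constTerm_wandering`), so the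
dimensions add up to `n`. The two representations glue to an invertible intertwiner of the whole
space carrying coordinate subspaces onto `M` and `N`; it conjugates the idempotent to a diagonal
projection. -/

instance : DecidableEq (FreeMonoid (Fin d)) := inferInstanceAs (DecidableEq (List (Fin d)))

theorem hasSum_norm_sq (x : HardySpace d) : HasSum (fun u => ‖x u‖ ^ 2) (‖x‖ ^ 2) := by
  have := lp.hasSum_norm (p := 2) (by norm_num) x
  simpa using this

theorem memℓp_two_of_le {f : FreeMonoid (Fin d) → ℂ} (x : HardySpace d) (h : ∀ u, ‖f u‖ ≤ ‖x u‖) :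
    Memℓp f 2 := by
  refine memℓp_gen ?_
  have := (hasSum_norm_sq x).summable
  refine Summable.of_nonneg_of_le (fun u => by positivity) (fun u => ?_) this
  simpa using pow_le_pow_left₀ (norm_nonneg _) (h u) 2

/-! ## The right free shifts -/

theorem mul_of_injective (k : Fin d) :
    Function.Injective fun w : FreeMonoid (Fin d) => w * FreeMonoid.of k :=
  mul_left_injective _

theorem mul_of_inj {j k : Fin d} {v w : FreeMonoid (Fin d)} :
    v * FreeMonoid.of j = w * FreeMonoid.of k ↔ v = w ∧ j = k := by
  constructor
  · intro h
    have h' : v.toList ++ [j] = w.toList ++ [k] := congrArg FreeMonoid.toList h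
    have := List.append_inj' h' rfl
    exact ⟨FreeMonoid.toList.injective this.1, by simpa using this.2⟩
  · rintro ⟨rfl, rfl⟩; rfl

theorem mul_of_ne_one {k : Fin d} {v : FreeMonoid (Fin d)} : v * FreeMonoid.of k ≠ 1 := by
  intro h
  have := congrArg FreeMonoid.length h
  simp [FreeMonoid.length_mul] at this

theorem memℓp_extend_right (k : Fin d) (f : HardySpace d) :
    Memℓp (Function.extend (fun w => w * FreeMonoid.of k) (f : FreeMonoid (Fin d) → ℂ) 0) 2 := by
  refine memℓp_gen ?_
  refine ((mul_of_injective k).summable_iff fun w hw => ?_).1 ?_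
  · rw [Function.extend_apply' _ _ _ (by simpa using hw)]
    simp
  · have := (lp.memℓp f).summable (by norm_num)
    refine this.congr fun w => ?_
    simp [(mul_of_injective k).extend_apply]

/-- The right free shift, right multiplication by the `k`-th variable. -/
noncomputable def rightShift (k : Fin d) : HardySpace d →ₗᵢ[ℂ] HardySpace d where
  toFun f := ⟨Function.extend (fun w => w * FreeMonoid.of k) (f : FreeMonoid (Fin d) → ℂ) 0,
    memℓp_extend_right k f⟩
  map_add' f g := by
    ext w
    change (Function.extend (fun w => w * FreeMonoid.of k)
        ((f : FreeMonoid (Fin d) → ℂ) + (g : FreeMonoid (Fin d) → ℂ)) 0 w : ℂ) =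
      Function.extend (fun w => w * FreeMonoid.of k) (f : FreeMonoid (Fin d) → ℂ) 0 w +
        Function.extend (fun w => w * FreeMonoid.of k) (g : FreeMonoid (Fin d) → ℂ) 0 w
    by_cases hw : ∃ v, v * FreeMonoid.of k = w
    · obtain ⟨v, rfl⟩ := hw
      simp only [(mul_of_injective k).extend_apply, Pi.add_apply]
    · simp only [Function.extend_apply' _ _ _ hw, Pi.zero_apply, add_zero]
  map_smul' c f := by
    ext w
    by_cases hw : ∃ v, v * FreeMonoid.of k = w
    · obtain ⟨v, rfl⟩ := hw
      simp [(mul_of_injective k).extend_apply]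
    · simp [Function.extend_apply' _ _ _ hw]
  norm_map' f := by
    have h2 : 0 < (2 : ℝ≥0∞).toReal := by norm_num
    rw [lp.norm_eq_tsum_rpow h2, lp.norm_eq_tsum_rpow h2]
    congr 1
    rw [← (mul_of_injective k).tsum_eq]
    · refine tsum_congr fun w => ?_
      simp [(mul_of_injective k).extend_apply]
    · intro w hw
      by_contra hw'
      refine hw ?_
      simp [Function.extend_apply' _ _ _ (by simpa using hw')]

theorem rightShift_apply_mul_of (k : Fin d) (x : HardySpace d) (v : FreeMonoid (Fin d)) :
    rightShift k x (v * FreeMonoid.of k) = x v :=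
  (mul_of_injective k).extend_apply _ _ _

theorem rightShift_apply_of_forall_ne {k : Fin d} {u : FreeMonoid (Fin d)}
    (h : ∀ v, v * FreeMonoid.of k ≠ u) (x : HardySpace d) : rightShift k x u = 0 :=
  Function.extend_apply' _ _ _ (by simpa using h)

@[simp]
theorem rightShift_apply_one (k : Fin d) (x : HardySpace d) : rightShift k x 1 = 0 :=
  rightShift_apply_of_forall_ne (fun _ => mul_of_ne_one) x

theorem rightShift_apply_mul_of_ne {j k : Fin d} (h : j ≠ k) (x : HardySpace d)
    (v : FreeMonoid (Fin d)) : rightShift k x (v * FreeMonoid.of j) = 0 :=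
  rightShift_apply_of_forall_ne (fun _ hw => h (mul_of_inj.1 hw).2.symm) x

theorem rightShift_single (k : Fin d) (v : FreeMonoid (Fin d)) (c : ℂ) :
    rightShift k (lp.single 2 v c) = lp.single 2 (v * FreeMonoid.of k) c := by
  ext u
  by_cases hu : ∃ w, w * FreeMonoid.of k = u
  · obtain ⟨w, rfl⟩ := hu
    rw [rightShift_apply_mul_of, lp.single_apply, lp.single_apply]
    simp only [Pi.single_apply, mul_of_inj, and_true]
  · push Not at hu
    rw [rightShift_apply_of_forall_ne hu, lp.single_apply_ne]
    exact (hu v).symm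

open ContinuousLinearMap in
theorem adjoint_rightShift_apply (k : Fin d) (x : HardySpace d) (v : FreeMonoid (Fin d)) :
    adjoint (rightShift k).toContinuousLinearMap x v = x (v * FreeMonoid.of k) := by
  have h := adjoint_inner_right (rightShift k).toContinuousLinearMap (lp.single 2 v 1) x
  rw [LinearIsometry.coe_toContinuousLinearMap, rightShift_single, lp.inner_single_left,
    lp.inner_single_left] at h
  simpa using h

theorem eq_one_or_eq_mul_of (u : FreeMonoid (Fin d)) :
    u = 1 ∨ ∃ v k, u = v * FreeMonoid.of k := by
  rcases List.eq_nil_or_concat u.toList with h | ⟨v, k, h⟩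
  · exact Or.inl h
  · exact Or.inr ⟨FreeMonoid.ofList v, k, h.trans (by simp; rfl)⟩

/-- Induction on words, appending letters on the right. -/
theorem word_induction_right {p : FreeMonoid (Fin d) → Prop} (u : FreeMonoid (Fin d)) (one : p 1)
    (mul_of : ∀ v k, p v → p (v * FreeMonoid.of k)) : p u :=
  List.reverseRecOn (motive := fun l => p (FreeMonoid.ofList l)) u.toList one
    fun _ k hv => mul_of _ k hv

open ContinuousLinearMap in
/-- A vector is the sum of its constant term and its components in the ranges of the right
shifts. -/
theorem eq_single_add_sum_rightShift (x : HardySpace d) :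
    x = x 1 • lp.single 2 1 1 +
      ∑ k, rightShift k (adjoint (rightShift k).toContinuousLinearMap x) := by
  ext u
  rw [lp.coeFn_add, Pi.add_apply, lp.coeFn_sum, Finset.sum_apply, lp.coeFn_smul, Pi.smul_apply]
  rcases eq_one_or_eq_mul_of u with rfl | ⟨v, k, rfl⟩
  · simp
  · rw [lp.single_apply_ne _ _ _ mul_of_ne_one, Finset.sum_eq_single k,
      rightShift_apply_mul_of, adjoint_rightShift_apply]
    · simp
    · intro j _ hj
      exact rightShift_apply_mul_of_ne hj.symm _ _
    · simp

/-! ## Noncommutative convolution -/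

/-- The product of two noncommutative power series, given by their coefficients. -/
noncomputable def conv (f x : FreeMonoid (Fin d) → ℂ) (u : FreeMonoid (Fin d)) : ℂ :=
  ∑ i ∈ Finset.range (u.length + 1),
    f (FreeMonoid.ofList (u.toList.take i)) * x (FreeMonoid.ofList (u.toList.drop i))

@[simp]
theorem conv_one (f x : FreeMonoid (Fin d) → ℂ) : conv f x 1 = f 1 * x 1 := by
  simp [conv]

/-- Only the factorization with empty second factor uses the last letter in `f`; in all others that
letter belongs to `x`. This recursion is adapted to the right shifts, `conv_of_mul` to the left
ones. -/
theorem conv_mul_of (f x : FreeMonoid (Fin d) → ℂ) (v : FreeMonoid (Fin d)) (k : Fin d) :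
    conv f x (v * FreeMonoid.of k) =
      f (v * FreeMonoid.of k) * x 1 + conv f (fun w => x (w * FreeMonoid.of k)) v := by
  have hl : (v * FreeMonoid.of k).length = v.length + 1 := FreeMonoid.length_mul _ _
  have hv : v.length = v.toList.length := rfl
  rw [conv, hl, Finset.sum_range_succ, add_comm]
  congr 1
  · have h1 : (v * FreeMonoid.of k).toList.take (v.length + 1) = (v * FreeMonoid.of k).toList :=
      List.take_of_length_le hl.le
    have h2 : (v * FreeMonoid.of k).toList.drop (v.length + 1) = [] :=
      List.drop_of_length_le hl.le
    rw [h1, h2]; rfl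
  · refine Finset.sum_congr rfl fun i hi => ?_
    have hi' : i ≤ v.toList.length := by
      have := Finset.mem_range.1 hi; omega
    rw [FreeMonoid.toList_mul, List.take_append_of_le_length hi',
      List.drop_append_of_le_length hi']
    rfl

theorem conv_of_mul (f x : FreeMonoid (Fin d) → ℂ) (v : FreeMonoid (Fin d)) (k : Fin d) :
    conv f x (FreeMonoid.of k * v) =
      f 1 * x (FreeMonoid.of k * v) + conv (fun w => f (FreeMonoid.of k * w)) x v := by
  have hl : (FreeMonoid.of k * v).length = v.length + 1 := by
    rw [FreeMonoid.length_mul, FreeMonoid.length_of, add_comm]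
  rw [conv, hl, Finset.sum_range_succ', add_comm]
  rfl

/-- An operator commuting with the right shifts is the left multiplication by its symbol. -/
theorem apply_eq_conv {A : HardySpace d →L[ℂ] HardySpace d}
    (hA : ∀ k x, A (rightShift k x) = rightShift k (A x)) (x : HardySpace d)
    (u : FreeMonoid (Fin d)) : A x u = conv (A (lp.single 2 1 1)) x u := by
  -- In the decomposition of `x` along the right shifts, `A` passes through each shift, and at a
  -- word ending in `k` only the constant term and the `k`-th component survive, as in
  -- `conv_mul_of`.
  induction u using word_induction_right generalizing x with
  | one =>
    conv_lhs => rw [eq_single_add_sum_rightShift x]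
    rw [map_add, map_sum, map_smul, lp.coeFn_add, Pi.add_apply, lp.coeFn_sum, Finset.sum_apply,
      lp.coeFn_smul, Pi.smul_apply]
    simp [hA, mul_comm]
  | mul_of v k ih =>
    conv_lhs => rw [eq_single_add_sum_rightShift x]
    rw [map_add, map_sum, map_smul, lp.coeFn_add, Pi.add_apply, lp.coeFn_sum, Finset.sum_apply,
      lp.coeFn_smul, Pi.smul_apply, conv_mul_of, Finset.sum_eq_single k]
    · rw [hA, rightShift_apply_mul_of, ih, smul_eq_mul, mul_comm]
      congr 2
      funext w
      exact adjoint_rightShift_apply k x w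
    · intro j _ hj
      rw [hA]
      exact rightShift_apply_mul_of_ne hj.symm _ _
    · simp

/-! ## Left shifts -/

theorem leftShift_apply_of_mul (k : Fin d) (x : HardySpace d) (v : FreeMonoid (Fin d)) :
    leftShift k x (FreeMonoid.of k * v) = x v :=
  (of_mul_injective k).extend_apply _ _ _

theorem leftShift_apply_of_forall_ne {k : Fin d} {u : FreeMonoid (Fin d)}
    (h : ∀ v, FreeMonoid.of k * v ≠ u) (x : HardySpace d) : leftShift k x u = 0 :=
  Function.extend_apply' _ _ _ (by simpa using h)

@[simp]
theorem leftShift_apply_one (k : Fin d) (x : HardySpace d) : leftShift k x 1 = 0 :=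
  leftShift_apply_of_forall_ne (fun v h => by
    have := congrArg FreeMonoid.length h
    simp [FreeMonoid.length_mul] at this) x

theorem leftShift_apply_of_mul' (j k : Fin d) (x : HardySpace d) (v : FreeMonoid (Fin d)) :
    leftShift k x (FreeMonoid.of j * v) = if j = k then x v else 0 := by
  split_ifs with h
  · subst h; exact leftShift_apply_of_mul _ _ _
  · refine leftShift_apply_of_forall_ne (fun w hw => h ?_) x
    have hw' : k :: w.toList = j :: v.toList := congrArg FreeMonoid.toList hw
    exact (List.cons.inj hw').1.symm

theorem leftShift_rightShift (j k : Fin d) (x : HardySpace d) :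
    leftShift j (rightShift k x) = rightShift k (leftShift j x) := by
  ext u
  rcases eq_one_or_eq_mul_of u with rfl | ⟨v, i, rfl⟩
  · simp
  · induction v using FreeMonoid.casesOn with
    -- On a one-letter word both sides vanish: removing that letter from either end leaves the empty
    -- word, where a shifted vector is zero.
    | one =>
      have h1 : (1 : FreeMonoid (Fin d)) * FreeMonoid.of i = FreeMonoid.of i * 1 := by simp
      conv_lhs => rw [h1, leftShift_apply_of_mul', rightShift_apply_one, ite_self]
      rcases eq_or_ne i k with rfl | h
      · rw [rightShift_apply_mul_of, leftShift_apply_one]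
      · rw [rightShift_apply_mul_of_ne h]
    | of_mul l w =>
      conv_lhs => rw [mul_assoc, leftShift_apply_of_mul']
      rcases eq_or_ne i k with rfl | h
      · rw [rightShift_apply_mul_of, rightShift_apply_mul_of, leftShift_apply_of_mul']
      · rw [rightShift_apply_mul_of_ne h, rightShift_apply_mul_of_ne h, ite_self]

/-- Monomials in the left shifts have indicator symbols; this makes the Cesàro means computable by
convolution. -/
theorem lift_leftShift_apply (w : FreeMonoid (Fin d)) (x : HardySpace d) (u : FreeMonoid (Fin d)) :
    FreeMonoid.lift leftShift w x u = conv (Pi.single w 1) x u := by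
  induction w using FreeMonoid.inductionOn' generalizing u with
  | one =>
    rw [map_one, one_apply_eq_self]
    induction u using FreeMonoid.casesOn with
    | one => simp
    | of_mul j u =>
      rw [conv_of_mul]
      have : (fun w => (Pi.single 1 1 : FreeMonoid (Fin d) → ℂ) (FreeMonoid.of j * w)) = 0 := by
        funext w
        refine Pi.single_eq_of_ne (fun h => ?_) _
        have := congrArg FreeMonoid.length h
        simp [FreeMonoid.length_mul] at this
      rw [this]
      simp [conv]
  | of_mul k w ih =>
    rw [map_mul, FreeMonoid.lift_eval_of, mul_apply_eq_comp]
    have h1 : (Pi.single (FreeMonoid.of k * w) 1 : FreeMonoid (Fin d) → ℂ) 1 = 0 := by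
      refine Pi.single_eq_of_ne (fun h => ?_) _
      have := congrArg FreeMonoid.length h
      simp [FreeMonoid.length_mul] at this
      omega
    induction u using FreeMonoid.casesOn with
    | one => simp
    | of_mul j u =>
      rw [conv_of_mul, h1, zero_mul, zero_add, leftShift_apply_of_mul']
      split_ifs with h
      · subst h
        rw [ih]
        congr 1
        funext v
        simp [Pi.single_apply]
      · have : (fun v => (Pi.single (FreeMonoid.of k * w) 1 : FreeMonoid (Fin d) → ℂ)
            (FreeMonoid.of j * v)) = 0 := by
          funext v
          refine Pi.single_eq_of_ne (fun hw => h ?_) _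
          exact (List.cons.inj (congrArg FreeMonoid.toList hw : j :: v.toList = k :: w.toList)).1
        rw [this]
        simp [conv]

end

section

variable {d : ℕ}

/-! ## Cesàro means of left multipliers -/

/-- The part of `x` supported on the words of length in `(t - m, t]`. -/
noncomputable def band (m t : ℕ) (x : HardySpace d) : HardySpace d :=
  ⟨fun v => if v.length ≤ t ∧ t < v.length + m then x v else 0,
    memℓp_two_of_le x fun v => by split_ifs <;> simp⟩

theorem band_apply (m t : ℕ) (x : HardySpace d) (v : FreeMonoid (Fin d)) :
    band m t x v = if v.length ≤ t ∧ t < v.length + m then x v else 0 := rfl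

theorem sum_norm_sq_band_le (m N : ℕ) (x : HardySpace d) :
    ∑ t ∈ Finset.range N, ‖band m t x‖ ^ 2 ≤ m * ‖x‖ ^ 2 := by
  have h1 : HasSum (fun v => ∑ t ∈ Finset.range N, ‖band m t x v‖ ^ 2)
      (∑ t ∈ Finset.range N, ‖band m t x‖ ^ 2) :=
    hasSum_sum fun t _ => hasSum_norm_sq _
  refine hasSum_le (fun v => ?_) h1 ((hasSum_norm_sq x).mul_left (m : ℝ))
  have h2 : ∀ t, ‖band m t x v‖ ^ 2 =
      if v.length ≤ t ∧ t < v.length + m then ‖x v‖ ^ 2 else 0 := by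
    intro t
    rw [band_apply]
    split_ifs <;> simp
  simp only [h2]
  -- Each word is counted once per `t` with `v.length ≤ t < v.length + m`, so at most `m` times.
  rw [← Finset.sum_filter, Finset.sum_const, nsmul_eq_mul]
  refine mul_le_mul_of_nonneg_right ?_ (sq_nonneg _)
  have h3 : (Finset.range N).filter (fun t => v.length ≤ t ∧ t < v.length + m) ⊆
      Finset.Ico v.length (v.length + m) := fun t ht => by
    simpa using (Finset.mem_filter.1 ht).2
  have := Finset.card_le_card h3
  rw [Nat.card_Ico, Nat.add_sub_cancel_left] at this
  exact_mod_cast this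

theorem finite_length_lt (m : ℕ) : {w : FreeMonoid (Fin d) | w.length < m}.Finite :=
  List.finite_length_lt (Fin d) m

/-- The coefficients of the `m`-th Cesàro mean of a power series. -/
noncomputable def cesaroCoeff (m : ℕ) (f : FreeMonoid (Fin d) → ℂ) (w : FreeMonoid (Fin d)) : ℂ :=
  -- Truncated subtraction kills the words of length at least `m`.
  ((m - w.length : ℕ) : ℂ) / m * f w

/-- The left multiplier whose symbol is the `m`-th Cesàro mean of a power series. -/
noncomputable def cesaroMean (m : ℕ) (f : FreeMonoid (Fin d) → ℂ) :
    HardySpace d →L[ℂ] HardySpace d :=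
  ∑ w ∈ (finite_length_lt m).toFinset, cesaroCoeff m f w • FreeMonoid.lift leftShift w

theorem cesaroMean_mem_adjoin (m : ℕ) (f : FreeMonoid (Fin d) → ℂ) :
    cesaroMean m f ∈ Algebra.adjoin ℂ (Set.range (leftShift (d := d))) := by
  refine Subalgebra.sum_mem _ fun w _ => Subalgebra.smul_mem _ ?_ _
  rw [FreeMonoid.lift_apply]
  refine Subalgebra.list_prod_mem _ fun T hT => ?_
  obtain ⟨k, _, rfl⟩ := List.mem_map.1 hT
  exact Algebra.subset_adjoin ⟨k, rfl⟩

theorem cesaroMean_apply (m : ℕ) (f : FreeMonoid (Fin d) → ℂ) (x : HardySpace d)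
    (u : FreeMonoid (Fin d)) : cesaroMean m f x u = conv (cesaroCoeff m f) x u := by
  rw [cesaroMean, sum_apply, lp.coeFn_sum, Finset.sum_apply]
  simp only [smul_apply, lp.coeFn_smul, Pi.smul_apply, lift_leftShift_apply,
    conv, smul_eq_mul, Finset.mul_sum]
  rw [Finset.sum_comm]
  refine Finset.sum_congr rfl fun i _ => ?_
  rw [Finset.sum_eq_single (FreeMonoid.ofList (u.toList.take i))]
  · simp
  · intro w _ hw
    rw [Pi.single_eq_of_ne hw.symm]
    simp
  · intro h
    have : cesaroCoeff m f (FreeMonoid.ofList (u.toList.take i)) = 0 := by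
      have h' : m ≤ (FreeMonoid.ofList (u.toList.take i)).length := by simpa using h
      simp [cesaroCoeff, Nat.sub_eq_zero_of_le h']
    simp [this]

/-- A Cesàro mean is an average of compressions. -/
theorem conv_cesaroCoeff (m : ℕ) (f : FreeMonoid (Fin d) → ℂ) (x : HardySpace d)
    (u : FreeMonoid (Fin d)) :
    conv (cesaroCoeff m f) x u =
      (m : ℂ)⁻¹ * ∑ s ∈ Finset.range m, conv f (band m (u.length + s) x) u := by
  simp only [conv]
  rw [Finset.sum_comm, Finset.mul_sum]
  refine Finset.sum_congr rfl fun i hi => ?_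
  have hi' : i ≤ u.toList.length := by
    have := Finset.mem_range.1 hi
    have h : u.length = u.toList.length := rfl
    omega
  have h1 : (FreeMonoid.ofList (u.toList.take i)).length = i :=
    (List.length_take).trans (min_eq_left hi')
  have h2 : (FreeMonoid.ofList (u.toList.drop i)).length = u.length - i := List.length_drop
  have h3 : u.length = u.toList.length := rfl
  simp only [cesaroCoeff, h1, band_apply, h2]
  rw [← Finset.mul_sum, ← Finset.sum_filter, Finset.sum_const, nsmul_eq_mul]
  -- The term with prefix of length `i` survives in exactly the compressions with `s < m - i`: this
  -- count over `m` is the Cesàro weight.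
  have h4 : (Finset.range m).filter
      (fun s => u.length - i ≤ u.length + s ∧ u.length + s < u.length - i + m) =
      Finset.range (m - i) := by
    ext s
    simp only [Finset.mem_filter, Finset.mem_range]
    omega
  rw [h4, Finset.card_range]
  ring

theorem norm_sq_average_le (m : ℕ) (a : ℕ → ℂ) :
    ‖(m : ℂ)⁻¹ * ∑ s ∈ Finset.range m, a s‖ ^ 2 ≤
      (m : ℝ)⁻¹ * ∑ s ∈ Finset.range m, ‖a s‖ ^ 2 := by
  have h1 : ‖∑ s ∈ Finset.range m, a s‖ ^ 2 ≤ m * ∑ s ∈ Finset.range m, ‖a s‖ ^ 2 := by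
    have h2 := sq_sum_le_card_mul_sum_sq (s := Finset.range m) (f := fun s => ‖a s‖)
    rw [Finset.card_range] at h2
    exact (pow_le_pow_left₀ (norm_nonneg _) (norm_sum_le _ _) 2).trans h2
  rcases Nat.eq_zero_or_pos m with rfl | hm
  · simp
  · have hm' : (0 : ℝ) < m := by exact_mod_cast hm
    rw [norm_mul, mul_pow, norm_inv, Complex.norm_natCast]
    calc _ ≤ ((m : ℝ)⁻¹) ^ 2 * (m * ∑ s ∈ Finset.range m, ‖a s‖ ^ 2) := by gcongr
      _ = _ := by field_simp

/-- By `conv_cesaroCoeff`, the coefficient at `u` is an average of `m` coefficients of `A` applied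
to bands of `x`. Convexity of the square bounds the total by the average of the `‖A (band m t x)‖ ^
2`, and the bands cover each word at most `m` times, which cancels the factor `1 / m`. -/
theorem norm_cesaroMean_le (m : ℕ) {f : FreeMonoid (Fin d) → ℂ}
    {A : HardySpace d →L[ℂ] HardySpace d} (hA : ∀ x u, A x u = conv f x u) :
    ‖cesaroMean m f‖ ≤ ‖A‖ := by
  refine ContinuousLinearMap.opNorm_le_bound _ (norm_nonneg _) fun x => ?_
  refine le_of_sq_le_sq ?_ (by positivity)
  rw [← (hasSum_norm_sq _).tsum_eq]
  refine (hasSum_norm_sq _).summable.tsum_le_of_sum_le fun U => ?_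
  -- The window of bands depends on the length of `u`; `N` gives one finite range containing the
  -- windows of all `u ∈ U`, so that the sums can be exchanged.
  set N := U.sup (fun u => u.length + m) with hN
  have h1 : ∀ u ∈ U, ‖cesaroMean m f x u‖ ^ 2 ≤
      (m : ℝ)⁻¹ * ∑ t ∈ Finset.range N, ‖A (band m t x) u‖ ^ 2 := by
    intro u hu
    rw [cesaroMean_apply, conv_cesaroCoeff]
    refine (norm_sq_average_le _ _).trans ?_
    refine mul_le_mul_of_nonneg_left ?_ (by positivity)
    simp only [← hA]
    have h2 := Finset.sum_Ico_eq_sum_range (fun t => ‖A (band m t x) u‖ ^ 2)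
      u.length (u.length + m)
    rw [Nat.add_sub_cancel_left] at h2
    rw [← h2]
    refine Finset.sum_le_sum_of_subset_of_nonneg (fun t ht => ?_) fun _ _ _ => sq_nonneg _
    have h3 : u.length + m ≤ N := Finset.le_sup (f := fun u => FreeMonoid.length u + m) hu
    simp only [Finset.mem_Ico, Finset.mem_range] at ht ⊢
    omega
  have h4 : ∀ t, ∑ u ∈ U, ‖A (band m t x) u‖ ^ 2 ≤ ‖A‖ ^ 2 * ‖band m t x‖ ^ 2 := by
    intro t
    refine (sum_le_hasSum U (fun _ _ => sq_nonneg _) (hasSum_norm_sq _)).trans ?_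
    rw [← mul_pow]
    exact pow_le_pow_left₀ (norm_nonneg _) (A.le_opNorm _) 2
  calc _ ≤ ∑ u ∈ U, (m : ℝ)⁻¹ * ∑ t ∈ Finset.range N, ‖A (band m t x) u‖ ^ 2 :=
        Finset.sum_le_sum h1
    _ = (m : ℝ)⁻¹ * ∑ t ∈ Finset.range N, ∑ u ∈ U, ‖A (band m t x) u‖ ^ 2 := by
        rw [← Finset.mul_sum, Finset.sum_comm]
    _ ≤ (m : ℝ)⁻¹ * ∑ t ∈ Finset.range N, ‖A‖ ^ 2 * ‖band m t x‖ ^ 2 := by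
        gcongr with t _
        exact h4 t
    _ ≤ (m : ℝ)⁻¹ * (‖A‖ ^ 2 * (m * ‖x‖ ^ 2)) := by
        rw [← Finset.mul_sum]
        gcongr
        exact sum_norm_sq_band_le m N x
    _ = ((m : ℝ)⁻¹ * m) * (‖A‖ * ‖x‖) ^ 2 := by ring
    -- An inequality rather than an equality because of `m = 0`.
    _ ≤ 1 * (‖A‖ * ‖x‖) ^ 2 := by
        gcongr
        exact inv_mul_le_one
    _ = _ := one_mul _

open Filter Topology in
theorem tendsto_cesaroMean_apply (f : FreeMonoid (Fin d) → ℂ) (x : HardySpace d)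
    (u : FreeMonoid (Fin d)) :
    Tendsto (fun m => cesaroMean m f x u) atTop (𝓝 (conv f x u)) := by
  simp only [cesaroMean_apply, conv]
  refine tendsto_finsetSum _ fun i _ => Tendsto.mul_const _ ?_
  generalize FreeMonoid.ofList (u.toList.take i) = w
  have h1 : Tendsto (fun m : ℕ => (1 - (w.length : ℂ) / m) * f w) atTop
      (𝓝 ((1 - 0) * f w)) :=
    (tendsto_const_nhds.sub (tendsto_const_div_atTop_nhds_zero_nat _)).mul_const _
  rw [sub_zero, one_mul] at h1
  refine h1.congr' ?_
  filter_upwards [eventually_ge_atTop (w.length + 1)] with m hm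
  have hm0 : (m : ℂ) ≠ 0 := by
    have : m ≠ 0 := by omega
    exact_mod_cast this
  rw [cesaroCoeff, Nat.cast_sub (by omega), sub_div, div_self hm0]

open Filter Topology in
/-- A bounded sequence in the Hardy space converges weakly if it converges coordinatewise. -/
theorem tendsto_inner_of_tendsto_apply {x : ℕ → HardySpace d} {x₀ : HardySpace d} {C : ℝ}
    (hC : ∀ m, ‖x m‖ ≤ C) (hx : ∀ u, Tendsto (fun m => x m u) atTop (𝓝 (x₀ u)))
    (y : HardySpace d) : Tendsto (fun m => ⟪y, x m⟫_ℂ) atTop (𝓝 ⟪y, x₀⟫_ℂ) := by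
  have hC0 : 0 ≤ C := (norm_nonneg _).trans (hC 0)
  rw [Metric.tendsto_atTop]
  intro ε hε
  have hy := lp.hasSum_single (p := 2) (by norm_num) y
  have hδ : 0 < ε / 2 / (C + ‖x₀‖ + 1) := by positivity
  obtain ⟨U, hU⟩ := ((Metric.tendsto_nhds.1 hy) _ hδ).exists
  -- Testing against a finitely supported approximation of `y` involves finitely many coordinates;
  -- the uniform norm bound absorbs the error.
  set y' := ∑ u ∈ U, lp.single (E := fun _ => ℂ) 2 u (y u) with hy'
  have h1 : Tendsto (fun m => ⟪y', x m⟫_ℂ) atTop (𝓝 ⟪y', x₀⟫_ℂ) := by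
    simp only [hy', sum_inner, lp.inner_single_left]
    exact tendsto_finsetSum _ fun u _ => tendsto_const_nhds.inner (hx u)
  obtain ⟨M, hM⟩ := (Metric.tendsto_atTop.1 h1) (ε / 2) (half_pos hε)
  refine ⟨M, fun m hm => ?_⟩
  have h2 := hM m hm
  rw [dist_eq_norm, ← inner_sub_right] at h2 ⊢
  have h3 : ⟪y, x m - x₀⟫_ℂ = ⟪y', x m - x₀⟫_ℂ - ⟪y' - y, x m - x₀⟫_ℂ := by
    rw [← inner_sub_left, sub_sub_cancel]
  have h4 : ‖⟪y' - y, x m - x₀⟫_ℂ‖ ≤ ε / 2 := by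
    refine (norm_inner_le_norm _ _).trans ?_
    have h5 : ‖x m - x₀‖ ≤ C + ‖x₀‖ + 1 :=
      (norm_sub_le _ _).trans (by linarith [hC m])
    have h6 : ‖y' - y‖ ≤ ε / 2 / (C + ‖x₀‖ + 1) := by
      rw [← dist_eq_norm]; exact hU.le
    calc _ ≤ ε / 2 / (C + ‖x₀‖ + 1) * (C + ‖x₀‖ + 1) := by gcongr
      _ = ε / 2 := div_mul_cancel₀ _ (by positivity)
  rw [h3]
  calc _ ≤ ‖⟪y', x m - x₀⟫_ℂ‖ + ‖⟪y' - y, x m - x₀⟫_ℂ‖ := norm_sub_le _ _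
    _ < ε := by linarith

/-! ## The Hardy algebra is the commutant of the right shifts -/

open Filter Topology in
/-- A bounded sequence of operators that converges weakly converges ultraweakly. -/
theorem tendsto_ultraweak_of_bounded {H : Type*} [NormedAddCommGroup H] [InnerProductSpace ℂ H]
    {T : ℕ → H →L[ℂ] H} {T₀ : H →L[ℂ] H} {C : ℝ} (hC : ∀ m, ‖T m‖ ≤ C)
    (hT : ∀ x y, Tendsto (fun m => ⟪y, T m x⟫_ℂ) atTop (𝓝 ⟪y, T₀ x⟫_ℂ)) :
    Tendsto T atTop (@nhds _ (ultraweakTopology H) T₀) := by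
  rw [nhds_induced, tendsto_comap_iff, tendsto_pi_nhds]
  rintro ⟨x, y⟩
  have hs : Summable fun k => C * (‖y.1 k‖ ^ 2 + ‖x.1 k‖ ^ 2) := (y.2.add x.2).mul_left _
  refine tendsto_tsum_of_dominated_convergence hs (fun k => hT _ _) (.of_forall fun m k => ?_)
  have hC0 : 0 ≤ C := (norm_nonneg _).trans (hC 0)
  have h1 : ‖y.1 k‖ * ‖x.1 k‖ ≤ ‖y.1 k‖ ^ 2 + ‖x.1 k‖ ^ 2 := by
    nlinarith [sq_nonneg (‖y.1 k‖ - ‖x.1 k‖), sq_nonneg (‖y.1 k‖), sq_nonneg (‖x.1 k‖)]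
  calc _ ≤ ‖y.1 k‖ * ‖T m (x.1 k)‖ := norm_inner_le_norm _ _
    _ ≤ ‖y.1 k‖ * (C * ‖x.1 k‖) := by
        gcongr
        exact (T m).le_of_opNorm_le (hC m) _
    _ = C * (‖y.1 k‖ * ‖x.1 k‖) := by ring
    _ ≤ _ := by gcongr

theorem continuous_inner_apply_ultraweak {H : Type*} [NormedAddCommGroup H]
    [InnerProductSpace ℂ H] (x y : H) :
    @Continuous _ _ (ultraweakTopology H) _ fun T : H →L[ℂ] H => ⟪y, T x⟫_ℂ := by
  let _ := ultraweakTopology H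
  have hs : ∀ z : H, Summable fun k => ‖(Pi.single 0 z : ℕ → H) k‖ ^ 2 := fun z =>
    summable_of_ne_finset_zero (s := {0}) fun k hk => by
      rw [Pi.single_eq_of_ne (by simpa using hk)]; simp
  have hc : Continuous (pairing (H := H)) := continuous_induced_dom
  refine ((continuous_apply (⟨Pi.single 0 x, hs x⟩, ⟨Pi.single 0 y, hs y⟩)).comp hc).congr
    fun T => ?_
  simp only [Function.comp_apply, pairing]
  rw [tsum_eq_single 0 fun k hk => by simp [Pi.single_eq_of_ne hk]]
  simp

/-- Moving `R` to the other side as its adjoint turns commutation into equalities between matrix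
coefficients of `T`, which are ultraweakly continuous. -/
theorem isClosed_centralizer_ultraweak (H : Type*) [NormedAddCommGroup H] [InnerProductSpace ℂ H]
    [CompleteSpace H] (s : Set (H →L[ℂ] H)) :
    @IsClosed _ (ultraweakTopology H) (Set.centralizer s) := by
  let _ := ultraweakTopology H
  have : Set.centralizer s = ⋂ R ∈ s, ⋂ x : H, ⋂ y : H,
      {T : H →L[ℂ] H | ⟪ContinuousLinearMap.adjoint R y, T x⟫_ℂ = ⟪y, T (R x)⟫_ℂ} := by
    ext T
    simp only [Set.mem_centralizer_iff, Set.mem_iInter, Set.mem_ofPred_eq,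
      ContinuousLinearMap.adjoint_inner_left]
    refine forall₂_congr fun R _ => ⟨fun h x y => ?_, fun h => ?_⟩
    · rw [← mul_apply_eq_comp, h, mul_apply_eq_comp]
    · ext x
      exact ext_inner_left ℂ fun y => h x y
  rw [this]
  exact isClosed_biInter fun R _ => isClosed_iInter fun x => isClosed_iInter fun y =>
    isClosed_eq (continuous_inner_apply_ultraweak _ _) (continuous_inner_apply_ultraweak _ _)

/-- The Hardy algebra is the commutant of the right shifts. -/
theorem mem_hardyAlgebra_iff {A : HardySpace d →L[ℂ] HardySpace d} :
    A ∈ HardyAlgebra d ↔ ∀ k x, A (rightShift k x) = rightShift k (A x) := by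
  let _ := ultraweakTopology (HardySpace d)
  have := isSemitopologicalSemiring_ultraweak (HardySpace d)
  constructor
  · intro hA k x
    set s : Set (HardySpace d →L[ℂ] HardySpace d) :=
      Set.range fun k => (rightShift k).toContinuousLinearMap
    -- The generators commute with the right shifts and a commutant is ultraweakly closed, so the
    -- closure stays inside it.
    have h1 : Algebra.adjoin ℂ (Set.range (leftShift (d := d))) ≤ Subalgebra.centralizer ℂ s := by
      refine Algebra.adjoin_le ?_
      rintro _ ⟨j, rfl⟩ _ ⟨k, rfl⟩
      ext1 x
      exact (leftShift_rightShift j k x).symm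
    have h2 := Subalgebra.topologicalClosure_minimal h1 (isClosed_centralizer_ultraweak _ s) hA
    exact (DFunLike.congr_fun (h2 _ ⟨k, rfl⟩) x).symm
  · intro hA
    -- Conversely `A` is the ultraweak limit of its Cesàro means, which are bounded, converge
    -- coefficientwise and lie in the generated algebra.
    have h1 := apply_eq_conv hA
    have h2 := tendsto_ultraweak_of_bounded (fun m => norm_cesaroMean_le m h1) fun x y =>
      tendsto_inner_of_tendsto_apply
        (fun m => (cesaroMean m _).le_of_opNorm_le (norm_cesaroMean_le m h1) x)
        (fun u => by rw [h1]; exact tendsto_cesaroMean_apply _ x u) y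
    exact mem_closure_of_tendsto h2 (.of_forall fun m => cesaroMean_mem_adjoin m _)

end

section

variable {d n k m : ℕ}

/-! ## Matrices over the Hardy algebra -/

@[simp]
theorem leftMultiplier_apply (F : Matrix (Fin n) (Fin k) (HardyAlgebra d)) (x : HardySpaceVec d k)
    (i : Fin n) : leftMultiplier F x i = ∑ j, (F i j).1 (x j) := by
  simp [leftMultiplier]

theorem leftMultiplier_mul (F : Matrix (Fin n) (Fin k) (HardyAlgebra d))
    (G : Matrix (Fin k) (Fin m) (HardyAlgebra d)) :
    leftMultiplier (F * G) = leftMultiplier F ∘L leftMultiplier G := by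
  ext1 x
  ext1 i
  simp only [leftMultiplier_apply, ContinuousLinearMap.comp_apply, Matrix.mul_apply,
    AddSubmonoidClass.coe_finsetSum, sum_apply, map_sum, MulMemClass.coe_mul, mul_apply_eq_comp]
  exact Finset.sum_comm

theorem leftMultiplier_one : leftMultiplier (1 : Matrix (Fin n) (Fin n) (HardyAlgebra d)) =
    ContinuousLinearMap.id ℂ _ := by
  ext1 x
  ext1 i
  rw [leftMultiplier_apply, Finset.sum_eq_single i]
  · simp
  · intro j _ hj
    simp [Matrix.one_apply_ne hj.symm]
  · simp

/-- The inclusion of the `j`-th summand of the vector-valued Hardy space. -/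
noncomputable def inclusion (j : Fin n) : HardySpace d →L[ℂ] HardySpaceVec d n :=
  (PiLp.continuousLinearEquiv 2 ℂ fun _ : Fin n => HardySpace d).symm.toContinuousLinearMap ∘L
    ContinuousLinearMap.single ℂ (fun _ : Fin n => HardySpace d) j

theorem inclusion_apply (j : Fin n) (x : HardySpace d) (i : Fin n) :
    inclusion j x i = if i = j then x else 0 := by
  simp [inclusion]

theorem sum_inclusion (x : HardySpaceVec d n) : ∑ j, inclusion j (x j) = x := by
  ext1 i
  simp [inclusion_apply]

theorem leftMultiplier_injective :
    Function.Injective (leftMultiplier (d := d) (n := n) (k := k)) := by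
  intro F G h
  refine Matrix.ext fun i j => Subtype.ext (ContinuousLinearMap.ext fun x => ?_)
  have := congrArg (fun y : HardySpaceVec d n => y i) (DFunLike.congr_fun h (inclusion j x))
  simpa [inclusion_apply, apply_ite] using this

/-- The right free shift on the vector-valued Hardy space. -/
noncomputable def vecShift (l : Fin d) : HardySpaceVec d n →ₗᵢ[ℂ] HardySpaceVec d n where
  toFun x := WithLp.toLp 2 fun i => rightShift l (x i)
  map_add' x y := by ext1 i; simp
  map_smul' c x := by ext1 i; simp
  norm_map' x := by
    simp [PiLp.norm_eq_of_L2]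

@[simp]
theorem vecShift_apply (l : Fin d) (x : HardySpaceVec d n) (i : Fin n) :
    vecShift l x i = rightShift l (x i) := rfl

theorem vecShift_inclusion (l : Fin d) (j : Fin n) (x : HardySpace d) :
    vecShift l (inclusion j x) = inclusion j (rightShift l x) := by
  ext1 i
  simp only [vecShift_apply, inclusion_apply]
  split_ifs <;> simp

theorem leftMultiplier_vecShift (F : Matrix (Fin n) (Fin k) (HardyAlgebra d)) (l : Fin d)
    (x : HardySpaceVec d k) : leftMultiplier F (vecShift l x) = vecShift l (leftMultiplier F x) := by
  ext1 i
  simp only [leftMultiplier_apply, vecShift_apply, map_sum]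
  exact Finset.sum_congr rfl fun j _ => mem_hardyAlgebra_iff.1 (F i j).2 l (x j)

/-- The entries of an intertwiner commute with the right shifts, hence lie in `HardyAlgebra d`. Any
intertwiner built geometrically is thereby a matrix over the algebra. -/
theorem exists_leftMultiplier_eq {T : HardySpaceVec d k →L[ℂ] HardySpaceVec d n}
    (hT : ∀ l x, T (vecShift l x) = vecShift l (T x)) :
    ∃ F : Matrix (Fin n) (Fin k) (HardyAlgebra d), leftMultiplier F = T := by
  refine ⟨Matrix.of fun i j => ⟨PiLp.proj 2 (fun _ : Fin n => HardySpace d) i ∘L T ∘L inclusion j,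
    mem_hardyAlgebra_iff.2 fun l x => ?_⟩, ?_⟩
  · simp [← vecShift_inclusion, hT]
  · ext1 x
    ext1 i
    rw [leftMultiplier_apply]
    conv_rhs => rw [← sum_inclusion x]
    simp

/-- The constant coefficient of an element of the Hardy algebra. -/
noncomputable def constCoeff (d : ℕ) : HardyAlgebra d →+* ℂ where
  toFun A := A.1 (lp.single 2 1 1) 1
  map_one' := by simp
  -- The empty word has a single factorization, so the constant coefficient of a convolution is a
  -- product.
  map_mul' A B := by
    rw [MulMemClass.coe_mul, mul_apply_eq_comp, apply_eq_conv (mem_hardyAlgebra_iff.1 A.2),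
      conv_one]
  map_zero' := by simp
  map_add' A B := by simp

theorem exists_inverse_of_isInvertible {F : Matrix (Fin n) (Fin k) (HardyAlgebra d)}
    (hF : (leftMultiplier F).IsInvertible) :
    ∃ G : Matrix (Fin k) (Fin n) (HardyAlgebra d), F * G = 1 ∧ G * F = 1 := by
  obtain ⟨e, he⟩ := hF
  have he' : ∀ x, leftMultiplier F x = e x := fun x => by rw [← he]; rfl
  -- The inverse of an intertwiner is again an intertwiner.
  obtain ⟨G, hG⟩ := exists_leftMultiplier_eq (T := e.symm.toContinuousLinearMap) fun l x => by
    refine e.injective ?_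
    simp [← he', leftMultiplier_vecShift]
    simp [he']
  refine ⟨G, leftMultiplier_injective ?_, leftMultiplier_injective ?_⟩
  · rw [leftMultiplier_mul, leftMultiplier_one, hG]
    ext1 x
    simp [he', -leftMultiplier_apply]
  · rw [leftMultiplier_mul, leftMultiplier_one, hG]
    ext1 x
    simp [he', -leftMultiplier_apply]

theorem isInvertible_leftMultiplier_iff (F : Matrix (Fin n) (Fin k) (HardyAlgebra d)) :
    (leftMultiplier F).IsInvertible ↔
      n = k ∧ ∃ G : Matrix (Fin k) (Fin n) (HardyAlgebra d), F * G = 1 ∧ G * F = 1 := by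
  constructor
  · intro hF
    obtain ⟨G, h1, h2⟩ := exists_inverse_of_isInvertible hF
    refine ⟨?_, G, h1, h2⟩
    -- Constant coefficients give mutually inverse rectangular matrices over `ℂ`, which must be
    -- square.
    have h3 := congrArg (fun M => M.map (constCoeff d)) h1
    have h4 := congrArg (fun M => M.map (constCoeff d)) h2
    simp only [Matrix.map_mul, Matrix.map_one _ (map_zero _) (map_one _)] at h3 h4
    simpa using Matrix.square_of_invertible _ _ h3 h4
  · rintro ⟨-, G, h1, h2⟩
    refine ContinuousLinearMap.IsInvertible.of_inverse (g := leftMultiplier G) ?_ ?_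
    · rw [← leftMultiplier_mul, h1, leftMultiplier_one]
    · rw [← leftMultiplier_mul, h2, leftMultiplier_one]

end

section

variable {d n : ℕ}

/-! ## Wandering subspaces -/

open ContinuousLinearMap in
theorem inner_rightShift_of_ne {j l : Fin d} (h : j ≠ l) (x y : HardySpace d) :
    ⟪rightShift j x, rightShift l y⟫_ℂ = 0 := by
  have h1 : adjoint (rightShift j).toContinuousLinearMap (rightShift l y) = 0 := by
    ext v
    rw [adjoint_rightShift_apply, rightShift_apply_mul_of_ne h]
    rfl
  have h2 := adjoint_inner_right (rightShift j).toContinuousLinearMap x (rightShift l y)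
  rw [h1, inner_zero_right] at h2
  exact h2.symm

theorem inner_vecShift_of_ne {j l : Fin d} (h : j ≠ l) (x y : HardySpaceVec d n) :
    ⟪vecShift j x, vecShift l y⟫_ℂ = 0 := by
  simp [PiLp.inner_apply, inner_rightShift_of_ne h]

/-- The vector of constant terms. -/
noncomputable def constTerm (d n : ℕ) : HardySpaceVec d n →ₗ[ℂ] (Fin n → ℂ) where
  toFun x i := x i 1
  map_add' x y := by ext i; simp
  map_smul' c x := by ext i; simp

@[simp]
theorem constTerm_apply (x : HardySpaceVec d n) (i : Fin n) : constTerm d n x i = x i 1 := rfl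

theorem constTerm_vecShift (l : Fin d) (x : HardySpaceVec d n) : constTerm d n (vecShift l x) = 0 := by
  ext i
  simp

theorem constTerm_surjective : Function.Surjective (constTerm d n) := fun c =>
  ⟨WithLp.toLp 2 fun i => lp.single 2 1 (c i), by ext i; simp⟩

open ContinuousLinearMap in
theorem exists_eq_sum_vecShift {x : HardySpaceVec d n} (hx : constTerm d n x = 0) :
    ∃ y : Fin d → HardySpaceVec d n, x = ∑ l, vecShift l (y l) := by
  refine ⟨fun l => WithLp.toLp 2 fun i => adjoint (rightShift l).toContinuousLinearMap (x i), ?_⟩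
  ext1 i
  have h : x i 1 = 0 := congrFun hx i
  conv_lhs => rw [eq_single_add_sum_rightShift (x i), h, zero_smul, zero_add]
  simp

/-- The wandering subspace of a submodule: its elements orthogonal to the shifts of all its
elements. -/
def wandering (M : Submodule ℂ (HardySpaceVec d n)) : Submodule ℂ (HardySpaceVec d n) where
  carrier := {x | x ∈ M ∧ ∀ l, ∀ y ∈ M, ⟪vecShift l y, x⟫_ℂ = 0}
  add_mem' {x y} hx hy := ⟨M.add_mem hx.1 hy.1, fun l z hz => by
    rw [inner_add_right, hx.2 l z hz, hy.2 l z hz, add_zero]⟩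
  zero_mem' := ⟨M.zero_mem, fun _ _ _ => inner_zero_right _⟩
  smul_mem' c x hx := ⟨M.smul_mem c hx.1, fun l z hz => by
    rw [inner_smul_right, hx.2 l z hz, mul_zero]⟩

variable {M N : Submodule ℂ (HardySpaceVec d n)}

theorem wandering_le : wandering M ≤ M := fun _ hx => hx.1

theorem inner_sum_vecShift_of_mem_wandering {w : HardySpaceVec d n} (hw : w ∈ wandering M)
    {y : Fin d → HardySpaceVec d n} (hy : ∀ l, y l ∈ M) : ⟪∑ l, vecShift l (y l), w⟫_ℂ = 0 := by
  rw [sum_inner]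
  exact Finset.sum_eq_zero fun l _ => hw.2 l _ (hy l)

open ContinuousLinearMap in
/-- Every element of a closed shift-invariant subspace is the sum of a wandering vector and of
shifts of elements of the subspace. -/
theorem exists_sub_sum_vecShift_mem_wandering [M.HasOrthogonalProjection]
    (hM : ∀ l, ∀ x ∈ M, vecShift l x ∈ M) {x : HardySpaceVec d n} (hx : x ∈ M) :
    ∃ y : Fin d → HardySpaceVec d n, (∀ l, y l ∈ M) ∧ x - ∑ l, vecShift l (y l) ∈ wandering M := by
  have hy : ∀ l, M.starProjection (adjoint (vecShift l).toContinuousLinearMap x) ∈ M :=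
    fun l => Submodule.starProjection_apply_mem _ _
  -- Since the shifts are isometries with orthogonal ranges, the sum of these shifted vectors is the
  -- orthogonal projection of `x` onto the sum of the shifts of `M`.
  refine ⟨fun l => M.starProjection (adjoint (vecShift l).toContinuousLinearMap x), hy,
    M.sub_mem hx (M.sum_mem fun l _ => hM l _ (hy l)), fun l z hz => ?_⟩
  rw [inner_sub_right, inner_sum, Finset.sum_eq_single l, LinearIsometry.inner_map_map,
    ← Submodule.inner_starProjection_left_eq_right, Submodule.starProjection_eq_self_iff.2 hz,
    adjoint_inner_right]
  · exact sub_self _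
  · intro j _ hj
    exact inner_vecShift_of_ne hj.symm _ _
  · simp

/-- The right shift by a word. -/
noncomputable def wordShift (u : FreeMonoid (Fin d)) : HardySpaceVec d n →ₗᵢ[ℂ] HardySpaceVec d n :=
  -- Products of isometries are composites, in which the leftmost factor acts last; reversing the
  -- word makes its last letter act last.
  FreeMonoid.lift (M := HardySpaceVec d n →ₗᵢ[ℂ] HardySpaceVec d n) vecShift u.reverse

@[simp]
theorem wordShift_one (x : HardySpaceVec d n) : wordShift 1 x = x := rfl

theorem wordShift_mul_of (u : FreeMonoid (Fin d)) (l : Fin d) (x : HardySpaceVec d n) :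
    wordShift (u * FreeMonoid.of l) x = vecShift l (wordShift u x) := by
  rw [wordShift, FreeMonoid.reverse_mul, map_mul, FreeMonoid.reverse_of, FreeMonoid.lift_eval_of]
  rfl

theorem wordShift_mem (hM : ∀ l, ∀ x ∈ M, vecShift l x ∈ M) {x : HardySpaceVec d n} (hx : x ∈ M)
    (u : FreeMonoid (Fin d)) : wordShift u x ∈ M := by
  induction u using word_induction_right with
  | one => exact hx
  | mul_of v l ih => rw [wordShift_mul_of]; exact hM l _ ih

/-- Equal last letters cancel because shifts are isometric, and different ones give orthogonal
ranges. If one word runs out first, a wandering vector is paired with a shift of an element of `M`.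
-/
theorem inner_wordShift_of_mem_wandering (hM : ∀ l, ∀ x ∈ M, vecShift l x ∈ M)
    {w w' : HardySpaceVec d n} (hw : w ∈ wandering M) (hw' : w' ∈ wandering M)
    (u v : FreeMonoid (Fin d)) :
    ⟪wordShift u w, wordShift v w'⟫_ℂ = if u = v then ⟪w, w'⟫_ℂ else 0 := by
  induction u using word_induction_right generalizing v with
  | one =>
    rcases eq_one_or_eq_mul_of v with rfl | ⟨v, l, rfl⟩
    · simp
    · rw [if_neg mul_of_ne_one.symm, wordShift_one, wordShift_mul_of, ← inner_conj_symm,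
        hw.2 l _ (wordShift_mem hM hw'.1 v), map_zero]
  | mul_of u j ih =>
    rcases eq_one_or_eq_mul_of v with rfl | ⟨v, l, rfl⟩
    · rw [if_neg mul_of_ne_one, wordShift_one, wordShift_mul_of,
        hw'.2 j _ (wordShift_mem hM hw.1 u)]
    · rw [wordShift_mul_of, wordShift_mul_of]
      rcases eq_or_ne j l with rfl | h
      · rw [LinearIsometry.inner_map_map, ih]
        simp
      · rw [inner_vecShift_of_ne h, if_neg fun h' => h (mul_of_inj.1 h').2]

theorem eq_sum_vecShift_of_forall_inner_wordShift [M.HasOrthogonalProjection]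
    (hM : ∀ l, ∀ x ∈ M, vecShift l x ∈ M) {x : HardySpaceVec d n} (hx : x ∈ M)
    (h : ∀ w ∈ wandering M, ∀ u, ⟪wordShift u w, x⟫_ℂ = 0) :
    ∃ y : Fin d → HardySpaceVec d n, x = ∑ l, vecShift l (y l) ∧
      ∀ l, y l ∈ M ∧ ∀ w ∈ wandering M, ∀ u, ⟪wordShift u w, y l⟫_ℂ = 0 := by
  obtain ⟨y, hy, hw⟩ := exists_sub_sum_vecShift_mem_wandering hM hx
  -- This wandering vector is orthogonal to `x`, by the hypothesis at the empty word, and to the sum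
  -- of shifts, hence to itself.
  have h1 : x - ∑ l, vecShift l (y l) = 0 := by
    refine (inner_self_eq_zero (𝕜 := ℂ)).1 ?_
    have h2 := inner_sum_vecShift_of_mem_wandering hw hy
    have h3 := h _ hw 1
    rw [wordShift_one] at h3
    rw [inner_sub_right, h3, ← inner_conj_symm _ (∑ l, _), h2, map_zero, sub_zero]
  rw [sub_eq_zero] at h1
  refine ⟨y, h1, fun l => ⟨hy l, fun w hw u => ?_⟩⟩
  have h3 := h w hw (u * FreeMonoid.of l)
  rw [h1, wordShift_mul_of, inner_sum, Finset.sum_eq_single l, LinearIsometry.inner_map_map] at h3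
  · exact h3
  · intro j _ hj
    exact inner_vecShift_of_ne hj.symm _ _
  · simp

/-- A closed shift-invariant subspace is generated by its wandering subspace. -/
theorem eq_zero_of_forall_inner_wordShift [M.HasOrthogonalProjection]
    (hM : ∀ l, ∀ x ∈ M, vecShift l x ∈ M) {x : HardySpaceVec d n} (hx : x ∈ M)
    (h : ∀ w ∈ wandering M, ∀ u, ⟪wordShift u w, x⟫_ℂ = 0) : x = 0 := by
  ext i u
  change x i u = 0
  -- The vectors `y l` inherit the hypotheses on `x`, and reading the coefficient at a word through
  -- them removes its last letter.
  induction u using word_induction_right generalizing x with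
  | one =>
    obtain ⟨y, h1, -⟩ := eq_sum_vecShift_of_forall_inner_wordShift hM hx h
    rw [h1, WithLp.ofLp_sum, Finset.sum_apply, lp.coeFn_sum, Finset.sum_apply]
    exact Finset.sum_eq_zero fun j _ => rightShift_apply_one _ _
  | mul_of v l ih =>
    obtain ⟨y, h1, hy⟩ := eq_sum_vecShift_of_forall_inner_wordShift hM hx h
    rw [h1, WithLp.ofLp_sum, Finset.sum_apply, lp.coeFn_sum, Finset.sum_apply]
    refine Finset.sum_eq_zero fun j _ => ?_
    rw [vecShift_apply]
    rcases eq_or_ne l j with rfl | hj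
    · rw [rightShift_apply_mul_of]
      exact ih (hy l).1 (hy l).2
    · exact rightShift_apply_mul_of_ne hj _ _

/-! ### Beurling-type representation and the dimension count. -/

theorem continuousLinearMap_ext_single {Y : Type*} [NormedAddCommGroup Y] [NormedSpace ℂ Y]
    {S T : HardySpace d →L[ℂ] Y} (h : ∀ u, S (lp.single 2 u 1) = T (lp.single 2 u 1)) : S = T := by
  ext1 x
  have hx := lp.hasSum_single (p := 2) (by norm_num) x
  refine (S.hasSum hx).unique ?_
  convert T.hasSum hx using 2 with u
  have : lp.single (E := fun _ => ℂ) 2 u (x u) = x u • lp.single 2 u 1 := by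
    rw [← lp.single_smul, smul_eq_mul, mul_one]
  rw [this, map_smul, map_smul, h]

open ContinuousLinearMap in
/-- A Beurling-type theorem: a closed shift-invariant subspace with finite-dimensional wandering
subspace is the range of an injective operator intertwining the right shifts. -/
theorem exists_intertwining [M.HasOrthogonalProjection]
    (hM : ∀ l, ∀ x ∈ M, vecShift l x ∈ M) [FiniteDimensional ℂ (wandering M)] :
    ∃ V : Fin (Module.finrank ℂ (wandering M)) → HardySpace d →L[ℂ] HardySpaceVec d n,
      (∀ i l x, V i (rightShift l x) = vecShift l (V i x)) ∧ (∀ i x, V i x ∈ M) ∧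
      (∀ y ∈ M, ∃ x : Fin _ → HardySpace d, y = ∑ i, V i (x i)) ∧
      ∀ x : Fin _ → HardySpace d, ∑ i, V i (x i) = 0 → x = 0 := by
  set b := stdOrthonormalBasis ℂ (wandering M)
  have hb : ∀ i j, ⟪(b i : HardySpaceVec d n), (b j : HardySpaceVec d n)⟫_ℂ =
      if i = j then 1 else 0 := orthonormal_iff_ite.1 b.orthonormal
  have hO : ∀ i, Orthonormal ℂ fun u => wordShift u (b i : HardySpaceVec d n) := by
    intro i
    rw [orthonormal_iff_ite]
    intro u v
    rw [inner_wordShift_of_mem_wandering hM (b i).2 (b i).2, hb, if_pos rfl]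
  -- `V i` sends the basis vector of the word `u` to the translate by `u` of the `i`-th vector of an
  -- orthonormal basis of the wandering subspace.
  set V : Fin (Module.finrank ℂ (wandering M)) → HardySpace d →L[ℂ] HardySpaceVec d n :=
    fun i => (hO i).orthogonalFamily.linearIsometry.toContinuousLinearMap with hV
  have hVs : ∀ i u, V i (lp.single 2 u 1) = wordShift u (b i : HardySpaceVec d n) := by
    intro i u
    refine ((hO i).orthogonalFamily.linearIsometry_apply_single (i := u) 1).trans ?_
    simp
  have hVM : ∀ i x, V i x ∈ M := by
    intro i x
    have h1 : M.starProjection ∘L V i = V i := continuousLinearMap_ext_single fun u => by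
      rw [comp_apply, hVs]
      exact Submodule.starProjection_eq_self_iff.2 (wordShift_mem hM (wandering_le (b i).2) u)
    rw [← h1]
    exact Submodule.starProjection_apply_mem _ _
  -- The `V i` are isometries with pairwise orthogonal ranges. This gives injectivity, and makes `∑
  -- i, V i (adjoint (V i) y)` the candidate expansion of `y`.
  have hVV : ∀ i j x, adjoint (V i) (V j x) = if i = j then x else 0 := by
    intro i j x
    have h1 : adjoint (V i) ∘L V j = if i = j then ContinuousLinearMap.id ℂ _ else 0 := by
      refine continuousLinearMap_ext_single fun u => ?_
      ext v
      have h2 := adjoint_inner_right (V i) (lp.single 2 v 1) (V j (lp.single 2 u 1))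
      rw [hVs, hVs, lp.inner_single_left,
        inner_wordShift_of_mem_wandering hM (b i).2 (b j).2, hb] at h2
      rw [comp_apply, hVs]
      refine Eq.trans (by simpa using h2) ?_
      split_ifs <;> simp_all
    rw [← comp_apply, h1]
    split_ifs <;> rfl
  refine ⟨V, fun i l x => ?_, hVM, fun y hy => ⟨fun i => adjoint (V i) y, ?_⟩, fun x hx => ?_⟩
  · have h1 : V i ∘L (rightShift l).toContinuousLinearMap =
        (vecShift l).toContinuousLinearMap ∘L V i := continuousLinearMap_ext_single fun u => by
      simp [rightShift_single, hVs, wordShift_mul_of]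
    exact DFunLike.congr_fun h1 x
  · rw [← sub_eq_zero]
    -- The remainder lies in `M` and is orthogonal to all translates of wandering vectors.
    refine eq_zero_of_forall_inner_wordShift hM
      (M.sub_mem hy (M.sum_mem fun i _ => hVM i _)) fun w hw u => ?_
    have h1 : ∀ i, ⟪wordShift u (b i : HardySpaceVec d n),
        y - ∑ i, V i (adjoint (V i) y)⟫_ℂ = 0 := by
      intro i
      rw [← hVs, ← adjoint_inner_right, map_sub, map_sum]
      simp [hVV]
    have h2 : w = ∑ i, b.repr ⟨w, hw⟩ i • (b i : HardySpaceVec d n) := by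
      have := congrArg Subtype.val (b.sum_repr ⟨w, hw⟩)
      simpa using this.symm
    rw [h2, map_sum, sum_inner]
    refine Finset.sum_eq_zero fun i _ => ?_
    rw [map_smul, inner_smul_left, h1, mul_zero]
  · funext j
    have h1 := congrArg (adjoint (V j)) hx
    rw [map_sum, map_zero] at h1
    simpa [hVV] using h1

/-- Injectivity: if `v + w` has no constant term it is a sum of shifts; splitting these along `M`
and `N` exhibits `v` and `w` as sums of shifts of elements of their own subspaces, so each is
orthogonal to itself. Surjectivity: the constant term does not see the shifts subtracted in passing
from an element of `M` or `N` to its wandering part. `M` and `N` need not be orthogonal. -/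
theorem bijective_constTerm_wandering [M.HasOrthogonalProjection] [N.HasOrthogonalProjection]
    (hM : ∀ l, ∀ x ∈ M, vecShift l x ∈ M) (hN : ∀ l, ∀ x ∈ N, vecShift l x ∈ N)
    (h : IsCompl M N) :
    Function.Bijective ((constTerm d n).comp
      ((wandering M).subtype.coprod (wandering N).subtype)) := by
  constructor
  · rw [← LinearMap.ker_eq_bot, LinearMap.ker_eq_bot']
    rintro ⟨⟨v, hv⟩, ⟨w, hw⟩⟩ h0
    obtain ⟨y, hy⟩ := exists_eq_sum_vecShift (x := v + w) h0
    have h1 : ∀ l, ∃ p ∈ M, ∃ q ∈ N, p + q = y l := fun l =>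
      Submodule.mem_sup.1 (h.sup_eq_top ▸ Submodule.mem_top)
    choose p hp q hq hpq using h1
    have hv0 : v - ∑ l, vecShift l (p l) ∈ M :=
      M.sub_mem hv.1 (M.sum_mem fun l _ => hM l _ (hp l))
    have hw0 : w - ∑ l, vecShift l (q l) ∈ N :=
      N.sub_mem hw.1 (N.sum_mem fun l _ => hN l _ (hq l))
    have h2 : (v - ∑ l, vecShift l (p l)) + (w - ∑ l, vecShift l (q l)) = 0 := by
      have h3 : v + w = ∑ l, vecShift l (y l) := by simpa using hy
      simp only [← hpq, map_add, Finset.sum_add_distrib] at h3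
      rw [sub_add_sub_comm, h3, sub_self]
    have h3 : v - ∑ l, vecShift l (p l) = 0 := by
      refine Submodule.disjoint_def.1 h.disjoint _ hv0 ?_
      rw [eq_neg_of_add_eq_zero_left h2]
      exact N.neg_mem hw0
    have h4 : w - ∑ l, vecShift l (q l) = 0 := by rwa [h3, zero_add] at h2
    have h5 : v = 0 := by
      have := inner_sum_vecShift_of_mem_wandering hv hp
      rwa [← sub_eq_zero.1 h3, inner_self_eq_zero] at this
    have h6 : w = 0 := by
      have := inner_sum_vecShift_of_mem_wandering hw hq
      rwa [← sub_eq_zero.1 h4, inner_self_eq_zero] at this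
    subst h5 h6
    rfl
  · intro c
    obtain ⟨x, rfl⟩ := constTerm_surjective (d := d) c
    obtain ⟨p, hp, q, hq, rfl⟩ : ∃ p ∈ M, ∃ q ∈ N, p + q = x :=
      Submodule.mem_sup.1 (h.sup_eq_top ▸ Submodule.mem_top)
    obtain ⟨y, -, hv⟩ := exists_sub_sum_vecShift_mem_wandering hM hp
    obtain ⟨z, -, hw⟩ := exists_sub_sum_vecShift_mem_wandering hN hq
    refine ⟨(⟨_, hv⟩, ⟨_, hw⟩), ?_⟩
    simp [constTerm_vecShift]

end

/-! ### Similarity of idempotents to constant projections. -/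

section

variable {d n : ℕ}

/-- Two complementary closed shift-invariant subspaces are the images of complementary coordinate
subspaces under an invertible operator commuting with the right shifts. -/
theorem exists_intertwining_of_isCompl {M N : Submodule ℂ (HardySpaceVec d n)}
    [M.HasOrthogonalProjection] [N.HasOrthogonalProjection]
    (hM : ∀ l, ∀ x ∈ M, vecShift l x ∈ M) (hN : ∀ l, ∀ x ∈ N, vecShift l x ∈ N)
    (h : IsCompl M N) :
    ∃ (s : Fin n → Prop) (T : HardySpaceVec d n →L[ℂ] HardySpaceVec d n), T.IsInvertible ∧
      (∀ l x, T (vecShift l x) = vecShift l (T x)) ∧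
      ∀ i x, (s i → T (inclusion i x) ∈ M) ∧ (¬ s i → T (inclusion i x) ∈ N) := by
  have hbij := bijective_constTerm_wandering hM hN h
  set c := (constTerm d n).comp ((wandering M).subtype.coprod (wandering N).subtype)
  have : FiniteDimensional ℂ (wandering M) :=
    FiniteDimensional.of_injective (c.comp (LinearMap.inl ℂ _ _))
      (hbij.injective.comp LinearMap.inl_injective)
  have : FiniteDimensional ℂ (wandering N) :=
    FiniteDimensional.of_injective (c.comp (LinearMap.inr ℂ _ _))
      (hbij.injective.comp LinearMap.inr_injective)
  obtain ⟨V, hVc, hVM, hVs, hVi⟩ := exists_intertwining hM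
  obtain ⟨V', hVc', hVN, hVs', hVi'⟩ := exists_intertwining hN
  have hdim : Module.finrank ℂ (wandering M) + Module.finrank ℂ (wandering N) = n := by
    have := (LinearEquiv.ofBijective _ hbij).finrank_eq
    simpa using this
  -- The first block of coordinates is sent to `M` and the second to `N`; `s` records the block.
  set e : Fin (Module.finrank ℂ (wandering M)) ⊕ Fin (Module.finrank ℂ (wandering N)) ≃ Fin n :=
    finSumFinEquiv.trans (finCongr hdim)
  set U : Fin n → HardySpace d →L[ℂ] HardySpaceVec d n := fun i => Sum.elim V V' (e.symm i) with hU
  set T : HardySpaceVec d n →L[ℂ] HardySpaceVec d n :=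
    ∑ i, U i ∘L PiLp.proj 2 (fun _ : Fin n => HardySpace d) i with hT
  have hTx : ∀ x, T x = ∑ i, V i (x (e (.inl i))) + ∑ i, V' i (x (e (.inr i))) := by
    intro x
    rw [hT, sum_apply, ← e.sum_comp, Fintype.sum_sum_type]
    simp [hU]
  have hTi : ∀ i x, T (inclusion i x) = U i x := by
    intro i x
    rw [hT, sum_apply, Finset.sum_eq_single i]
    · simp [inclusion_apply]
    · intro j _ hj
      simp [inclusion_apply, hj]
    · simp
  have hinj : Function.Injective T := by
    rw [injective_iff_map_eq_zero]
    intro x hx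
    rw [hTx] at hx
    have h1 : ∑ i, V i (x (e (.inl i))) = 0 := by
      refine Submodule.disjoint_def.1 h.disjoint _ (M.sum_mem fun i _ => hVM i _) ?_
      rw [eq_neg_of_add_eq_zero_left hx]
      exact N.neg_mem (N.sum_mem fun i _ => hVN i _)
    have h2 : ∑ i, V' i (x (e (.inr i))) = 0 := by rwa [h1, zero_add] at hx
    have h3 := hVi _ h1
    have h4 := hVi' _ h2
    ext1 i
    obtain ⟨i, rfl⟩ := e.surjective i
    rcases i with i | i
    · exact congrFun h3 i
    · exact congrFun h4 i
  have hsurj : Function.Surjective T := by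
    intro y
    obtain ⟨p, hp, q, hq, rfl⟩ : ∃ p ∈ M, ∃ q ∈ N, p + q = y :=
      Submodule.mem_sup.1 (h.sup_eq_top ▸ Submodule.mem_top)
    obtain ⟨x, rfl⟩ := hVs p hp
    obtain ⟨x', rfl⟩ := hVs' q hq
    exact ⟨WithLp.toLp 2 fun i => Sum.elim x x' (e.symm i), by rw [hTx]; simp⟩
  refine ⟨fun i => (e.symm i).isLeft, T,
    -- Boundedness of the inverse is the open mapping theorem.
    ⟨ContinuousLinearEquiv.ofBijective T (LinearMap.ker_eq_bot.2 hinj)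
      (LinearMap.range_eq_top.2 hsurj), by ext1; rfl⟩, fun l x => ?_, fun i x => ?_⟩
  · rw [hTx, hTx, map_add, map_sum, map_sum]
    simp [hVc, hVc']
  · rw [hTi, hU]
    dsimp only
    rcases e.symm i with i | i
    · simpa using hVM i x
    · simpa using hVN i x

open scoped Classical in
theorem exists_similar_diagonal {E : Matrix (Fin n) (Fin n) (HardyAlgebra d)}
    (hE : IsIdempotentElem E) :
    ∃ (P : Matrix (Fin n) (Fin n) ℂ) (S : Matrix.GeneralLinearGroup (Fin n) (HardyAlgebra d)),
      IsStarProjection P ∧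
        E = ((S⁻¹ : Matrix.GeneralLinearGroup (Fin n) (HardyAlgebra d)) :
              Matrix (Fin n) (Fin n) (HardyAlgebra d)) * constMultiplier d P *
            (S : Matrix (Fin n) (Fin n) (HardyAlgebra d)) := by
  set L := leftMultiplier E with hL
  have hLL : ∀ x, L (L x) = L x := fun x => by
    have := leftMultiplier_mul E E
    rw [hE.eq] at this
    exact (DFunLike.congr_fun this x).symm
  -- The range of the idempotent, written as a kernel so that it is visibly closed.
  set M : Submodule ℂ (HardySpaceVec d n) := (ContinuousLinearMap.id ℂ _ - L).ker with hMd
  set N : Submodule ℂ (HardySpaceVec d n) := L.ker with hNd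
  have hMmem : ∀ x, x ∈ M ↔ L x = x := fun x => by
    rw [hMd, LinearMap.mem_ker]
    exact sub_eq_zero.trans eq_comm
  have hNmem : ∀ x, x ∈ N ↔ L x = 0 := fun x => Iff.rfl
  have : CompleteSpace M := (ContinuousLinearMap.isClosed_ker _).completeSpace_coe
  have : CompleteSpace N := (ContinuousLinearMap.isClosed_ker _).completeSpace_coe
  have hMN : IsCompl M N := by
    refine ⟨Submodule.disjoint_def.2 fun x hx hx' => ?_, codisjoint_iff.2 ?_⟩
    · rw [← (hMmem x).1 hx, (hNmem x).1 hx']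
    · refine eq_top_iff.2 fun x _ => Submodule.mem_sup.2
        ⟨L x, (hMmem _).2 (hLL x), x - L x, (hNmem _).2 ?_, add_sub_cancel _ _⟩
      rw [map_sub, hLL, sub_self]
  obtain ⟨s, T, hTinv, hTc, hTs⟩ := exists_intertwining_of_isCompl
    (fun l x hx => by rw [hMmem] at hx ⊢; rw [hL, leftMultiplier_vecShift, ← hL, hx])
    (fun l x hx => by rw [hNmem] at hx ⊢; rw [hL, leftMultiplier_vecShift, ← hL, hx, map_zero]) hMN
  obtain ⟨F, rfl⟩ := exists_leftMultiplier_eq hTc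
  obtain ⟨G, hFG, hGF⟩ := exists_inverse_of_isInvertible hTinv
  -- `F` carries coordinate subspaces into the range and kernel of `E`, so it plays the role of
  -- `S⁻¹` and `G` that of `S`.
  refine ⟨Matrix.diagonal fun i => if s i then 1 else 0, ⟨G, F, hGF, hFG⟩, ⟨?_, ?_⟩, ?_⟩
  · rw [IsIdempotentElem, Matrix.diagonal_mul_diagonal]
    congr 1
    funext i
    split_ifs <;> simp
  · rw [isSelfAdjoint_iff, Matrix.star_eq_conjTranspose, Matrix.diagonal_conjTranspose]
    congr 1
    funext i
    simp only [Pi.star_apply]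
    split_ifs <;> simp
  · change E = F * _ * G
    -- On each coordinate copy of the Fock space, both sides act as `F` if it is sent to the range
    -- and as zero if it is sent to the kernel.
    have h1 : E * F = F * constMultiplier d (Matrix.diagonal fun i => if s i then 1 else 0) := by
      refine leftMultiplier_injective ?_
      ext1 x
      rw [leftMultiplier_mul, leftMultiplier_mul, ← sum_inclusion x, map_sum, map_sum]
      refine Finset.sum_congr rfl fun i _ => ?_
      have h2 : leftMultiplier (constMultiplier d (Matrix.diagonal fun i => if s i then 1 else 0))
          (inclusion i (x i)) = if s i then inclusion i (x i) else 0 := by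
        ext1 j
        rw [leftMultiplier_apply, Finset.sum_eq_single i]
        · rcases eq_or_ne j i with rfl | hj
          · by_cases hs : s j <;> simp [constMultiplier, inclusion_apply, hs]
          · by_cases hs : s i <;> simp [constMultiplier, inclusion_apply, hs, hj]
        · intro k _ hk
          simp [inclusion_apply, hk]
        · simp
      rw [ContinuousLinearMap.comp_apply, ContinuousLinearMap.comp_apply, h2, ← hL]
      split_ifs with hs
      · exact (hMmem _).1 ((hTs i (x i)).1 hs)
      · rw [map_zero]
        exact (hNmem _).1 ((hTs i (x i)).2 hs)
    rw [← h1, mul_assoc, hFG, mul_one]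

end

end NCHardy

theorem mainTheorem7 (d : ℕ) :
    (∀ (n : ℕ) (E : Matrix (Fin n) (Fin n) (NCHardy.HardyAlgebra d)), IsIdempotentElem E →
      ∃ (P : Matrix (Fin n) (Fin n) ℂ) (S : Matrix.GeneralLinearGroup (Fin n) (NCHardy.HardyAlgebra d)),
        IsStarProjection P ∧
          E = ((S⁻¹ : Matrix.GeneralLinearGroup (Fin n) (NCHardy.HardyAlgebra d)) :
                Matrix (Fin n) (Fin n) (NCHardy.HardyAlgebra d)) *
              NCHardy.constMultiplier d P *
              (S : Matrix (Fin n) (Fin n) (NCHardy.HardyAlgebra d))) ∧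
    (∀ (n k : ℕ) (F : Matrix (Fin n) (Fin k) (NCHardy.HardyAlgebra d)),
      (NCHardy.leftMultiplier F).IsInvertible ↔
        n = k ∧ ∃ G : Matrix (Fin k) (Fin n) (NCHardy.HardyAlgebra d), F * G = 1 ∧ G * F = 1) := by
  exact ⟨fun _ _ hE => NCHardy.exists_similar_diagonal hE,
    fun _ _ F => NCHardy.isInvertible_leftMultiplier_iff F⟩
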